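/- Let $(m_n)_{n\ge 1}$ be a sequence of non-negative integers with $m_n/n \to \xi$ for some $\xi\in(0,1)$. For integers $n,p$, let $X_1,\dots,X_n$ be independent random vectors with law $N(0,\Sigma)$ on $\mathbb R^p$, where $\Sigma$ is a positive semidefinite matrix. For a set $S$ of coordinates such that the principal submatrix $\Sigma_S$ is positive definite, let $$T^2_S = n\,\bar X_S'\,\hat\Sigma_S^{-1}\,\bar X_S ,\qquad \bar X_S=\frac1n\sum_{i=1}^n X_{i,S},\qquad \hat\Sigma_S=\frac1{n-1}\sum_{i=1}^n (X_{i,S}-\bar X_S)(X_{i,S}-\bar X_S)'$$ be the one-sample Hotelling statistic computed from the coordinates in $S$ (set to $0$ where $\hat\Sigma_S$ is not invertible). Then there is an $N$, depending only on the sequence $(m_n)$, such that for all $n$, $p$ and $\Sigma$ and any two sets $S,S^*\subseteq\{1,\dots,p\}$ with $|S|=|S^*|=m_n$ and $\Sigma_S,\Sigma_{S^*}$ positive definite, the following holds. If $n\ge N$, then $T^2_S$ and $T^2_{S^*}$ are square integrable. At every $n$ at which both are square integrable, $\operatorname{Cov}(T^2_S,T^2_{S^*})\ge 0$. In particular, $\operatorname{Cov}(T^2_S,T^2_{S^*})$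 exists and is non-negative for all $n \ge N$. -/

import Mathlib

open MeasureTheory ProbabilityTheory Filter Topology
open scoped Matrix ENNReal

noncomputable section

/-- Sample mean of the observations `x 0, …, x (n-1)`, vectors with coordinates in `ι`. -/
def sampleMean {n : ℕ} {ι : Type*} (x : Fin n → ι → ℝ) : ι → ℝ :=
  (n : ℝ)⁻¹ • ∑ i, x i

/-- The (unbiased) sample covariance matrix `(n-1)⁻¹ ∑ᵢ (xᵢ - x̄)(xᵢ - x̄)ᵀ`. -/
def sampleCov {n : ℕ} {ι : Type*} (x : Fin n → ι → ℝ) : Matrix ι ι ℝ :=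
  ((n : ℝ) - 1)⁻¹ • ∑ i, Matrix.vecMulVec (x i - sampleMean x) (x i - sampleMean x)

/-- The one-sample Hotelling statistic `n x̄ᵀ Σ̂⁻¹ x̄` for the null hypothesis of zero mean. -/
def hotellingTSq {n : ℕ} {ι : Type*} [Fintype ι] [DecidableEq ι] (x : Fin n → ι → ℝ) : ℝ :=
  n * (sampleMean x ⬝ᵥ ((sampleCov x)⁻¹ *ᵥ sampleMean x))

/-- The random variable `T²_S`: the Hotelling statistic of the random observations
`X 0, …, X (n-1)`, computed from their coordinates in `S` only. -/
def hotellingOn {n p : ℕ} {Ω : Type*} (S : Finset (Fin p))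
    (X : Fin n → Ω → EuclideanSpace ℝ (Fin p)) (ω : Ω) : ℝ :=
  hotellingTSq (fun i (j : S) => X i ω j)

/-- The principal submatrix `Σ_S` of `Σ` with rows and columns in `S`. -/
def principalSubmatrix {p : ℕ} (C : Matrix (Fin p) (Fin p) ℝ) (S : Finset (Fin p)) :
    Matrix S S ℝ :=
  C.submatrix Subtype.val Subtype.val

/-- `X 0, …, X (n-1)` are independent, each with the normal law `N(0, C)` on `ℝᵖ`. -/
structure IsCenteredGaussianSample {n p : ℕ} {Ω : Type*} [MeasurableSpace Ω] (P : Measure Ω)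
    (C : Matrix (Fin p) (Fin p) ℝ) (X : Fin n → Ω → EuclideanSpace ℝ (Fin p)) : Prop where
  posSemidef : C.PosSemidef
  hasLaw : ∀ i, HasLaw (X i) (multivariateGaussian 0 C) P
  indep : iIndepFun X P

end

section

open scoped RealInnerProductSpace

/-! Non-negativity. Write the observations as `C^{1/2} g i` with `g i` standard Gaussian. The
Hotelling statistic is invariant under invertible linear maps, so `T²_S` depends only on the
coordinates of the `g i` in the span `U` of the rows of `C^{1/2}` indexed by `S`; likewise for `S'`
and a subspace `V` of the same dimension. In principal bases of `U` and `V` the inner products are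
`ρ i ≥ 0` on the diagonal and `0` elsewhere. The two coordinate vectors are then distributed as `√ρ
w + √(1-ρ) z` and `√ρ w + √(1-ρ) z'` with `w, z, z'` independent (`map_inner_prod_stdGaussian`).
Both statistics are the same function of these data, so given `w` they are independent and
identically distributed, and their covariance is the variance of a conditional expectation
(`covariance_prod_prod_nonneg`).

Square integrability. Up to the factor `n - 1`, `T²` is the leverage ratio of the constant vector
against the columns of an i.i.d. Gaussian array. By rotation invariance the constant vector may be
replaced by an independent Gaussian vector, with the columns held fixed
(`memLp_leverageRatio_pi_stdGaussian`). The ratio is then at most `‖g‖²` over a sum of eight squared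
Gaussian coordinates in directions orthogonal to the columns, and this quotient has a finite second
moment. Eight spare directions exist for large `n` because `ξ < 1`. -/

/-! ### Invariance of the Hotelling statistic -/

theorem sampleMean_mulVec {n : ℕ} {ι : Type*} [Fintype ι] (A : Matrix ι ι ℝ) (x : Fin n → ι → ℝ) :
    sampleMean (fun i => A *ᵥ x i) = A *ᵥ sampleMean x := by
  simp only [sampleMean, Matrix.mulVec_smul, Matrix.mulVec_sum]

theorem sampleCov_mulVec {n : ℕ} {ι : Type*} [Fintype ι] (A : Matrix ι ι ℝ) (x : Fin n → ι → ℝ) :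
    sampleCov (fun i => A *ᵥ x i) = A * sampleCov x * Aᵀ := by
  simp only [sampleCov, sampleMean_mulVec, ← Matrix.mulVec_sub, Matrix.mul_smul, Matrix.smul_mul,
    Matrix.mul_sum, Matrix.sum_mul, Matrix.mul_vecMulVec, Matrix.vecMulVec_mul,
    Matrix.vecMul_transpose]

/-- The Hotelling statistic is invariant under invertible linear maps of the observations. -/
theorem hotellingTSq_mulVec {n : ℕ} {ι : Type*} [Fintype ι] [DecidableEq ι] {A : Matrix ι ι ℝ}
    (hA : IsUnit A.det) (x : Fin n → ι → ℝ) :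
    hotellingTSq (fun i => A *ᵥ x i) = hotellingTSq x := by
  unfold hotellingTSq
  congr 1
  rw [sampleMean_mulVec, sampleCov_mulVec, Matrix.mul_inv_rev, Matrix.mul_inv_rev,
    Matrix.mulVec_mulVec, ← Matrix.mul_assoc, Matrix.mul_assoc _ A⁻¹ A, Matrix.nonsing_inv_mul A hA,
    Matrix.mul_one, ← Matrix.mulVec_mulVec, ← Matrix.transpose_nonsing_inv,
    Matrix.dotProduct_mulVec, Matrix.vecMul_transpose, Matrix.mulVec_mulVec,
    Matrix.nonsing_inv_mul A hA, Matrix.one_mulVec]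

theorem hotellingTSq_reindex {n : ℕ} {ι κ : Type*} [Fintype ι] [DecidableEq ι] [Fintype κ]
    [DecidableEq κ] (e : κ ≃ ι) (x : Fin n → ι → ℝ) :
    hotellingTSq (fun i j => x i (e j)) = hotellingTSq x := by
  have h1 : sampleMean (fun i j => x i (e j)) = sampleMean x ∘ e := by
    ext j; simp [sampleMean]
  have h2 : sampleCov (fun i j => x i (e j)) = (sampleCov x).submatrix e e := by
    ext j l
    simp [sampleCov, h1, Matrix.sum_apply, Matrix.vecMulVec_apply]
  unfold hotellingTSq
  rw [h1, h2, Matrix.inv_submatrix_equiv, Matrix.submatrix_mulVec_equiv]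
  congr 1
  rw [Function.comp_assoc, Equiv.self_comp_symm, Function.comp_id,
    comp_equiv_dotProduct_comp_equiv]

/-! ### The leverage ratio -/

/-- `aᵀ (‖g‖² YᵀY - a aᵀ)⁻¹ a` where `Y` has the columns `y j` and `a = Yᵀ g`. Up to a factor this
is the Hotelling statistic, with the constant vector replaced by `g`. -/
noncomputable def leverageRatio {κ E : Type*} [Fintype κ] [DecidableEq κ] [NormedAddCommGroup E]
    [InnerProductSpace ℝ E] (g : E) (y : κ → E) : ℝ :=
  (fun j => ⟪y j, g⟫) ⬝ᵥ
    ((Matrix.of fun i j => ‖g‖ ^ 2 * ⟪y i, y j⟫ - ⟪y i, g⟫ * ⟪y j, g⟫)⁻¹ *ᵥ fun j => ⟪y j, g⟫)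

section

variable {κ E : Type*} [Fintype κ] [DecidableEq κ] [NormedAddCommGroup E] [InnerProductSpace ℝ E]

theorem leverageRatio_map {F : Type*} [NormedAddCommGroup F] [InnerProductSpace ℝ F]
    (O : E ≃ₗᵢ[ℝ] F) (g : E) (y : κ → E) :
    leverageRatio (O g) (fun j => O (y j)) = leverageRatio g y := by
  simp [leverageRatio]

theorem inv_smul_of_ne_zero (M : Matrix κ κ ℝ) {c : ℝ} (hc : c ≠ 0) :
    (c • M)⁻¹ = c⁻¹ • M⁻¹ := by
  -- `Matrix.mul_inv_rev` also holds for singular matrices, so treating the scalar as a diagonal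
  -- matrix covers singular `M`.
  have := Matrix.mul_inv_rev (Matrix.diagonal fun _ : κ => c) M
  rw [← Matrix.smul_eq_diagonal_mul] at this
  rw [this]
  have h : (Matrix.diagonal fun _ : κ => c)⁻¹ = Matrix.diagonal fun _ => c⁻¹ := by
    apply Matrix.inv_eq_right_inv
    simp [hc]
  rw [h]
  ext i j
  simp [mul_comm]

theorem leverageRatio_smul {c : ℝ} (hc : c ≠ 0) (g : E) (y : κ → E) :
    leverageRatio (c • g) y = leverageRatio g y := by
  have hM : (Matrix.of fun i j => ‖c • g‖ ^ 2 * ⟪y i, y j⟫ - ⟪y i, c • g⟫ * ⟪y j, c • g⟫) =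
      (c ^ 2) • (Matrix.of fun i j => ‖g‖ ^ 2 * ⟪y i, y j⟫ - ⟪y i, g⟫ * ⟪y j, g⟫) := by
    ext i j
    simp [norm_smul, inner_smul_right, mul_pow]
    ring
  have ha : (fun j => ⟪y j, c • g⟫) = c • fun j => ⟪y j, g⟫ := by
    ext j; simp [inner_smul_right]
  rw [leverageRatio, hM, ha, inv_smul_of_ne_zero _ (pow_ne_zero 2 hc)]
  simp only [Matrix.smul_mulVec, Matrix.mulVec_smul, dotProduct_smul, smul_dotProduct, smul_eq_mul]
  rw [leverageRatio]
  field_simp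

/-- With `w = G⁻¹ a` and `v = ∑ w j • y j`, the quadratic form `wᵀ G w` is the Cauchy–Schwarz defect
of `v` and `g`, while `G w = a` turns it into `aᵀ w`. All later bounds use only this `v`, so no rank
assumption on the columns is needed. -/
theorem leverageRatio_eq_norm (g : E) (y : κ → E) :
    ∃ v ∈ Submodule.span ℝ (Set.range y), ⟪v, g⟫ = leverageRatio g y ∧
      leverageRatio g y = ‖g‖ ^ 2 * ‖v‖ ^ 2 - ⟪v, g⟫ ^ 2 := by
  set a : κ → ℝ := fun j => ⟪y j, g⟫ with ha
  set G : Matrix κ κ ℝ :=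
    Matrix.of fun i j => ‖g‖ ^ 2 * ⟪y i, y j⟫ - ⟪y i, g⟫ * ⟪y j, g⟫ with hG
  set w := G⁻¹ *ᵥ a with hw
  have ht : leverageRatio g y = a ⬝ᵥ w := rfl
  have hvg : ⟪∑ j, w j • y j, g⟫ = a ⬝ᵥ w := by
    simp [sum_inner, inner_smul_left, dotProduct, ha, mul_comm]
  refine ⟨∑ j, w j • y j, Submodule.sum_mem _ fun j _ => Submodule.smul_mem _ _
    (Submodule.subset_span ⟨j, rfl⟩), by rw [ht, hvg], ?_⟩
  have hq : w ⬝ᵥ (G *ᵥ w) = ‖g‖ ^ 2 * ‖∑ j, w j • y j‖ ^ 2 - ⟪∑ j, w j • y j, g⟫ ^ 2 := by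
    rw [← real_inner_self_eq_norm_sq (∑ j, w j • y j)]
    simp only [sum_inner, inner_sum, inner_smul_left, inner_smul_right, dotProduct, Matrix.mulVec,
      hG, Matrix.of_apply, sq, Finset.mul_sum, Finset.sum_mul, conj_trivial,
      ← Finset.sum_sub_distrib]
    rw [Finset.sum_comm]
    refine Finset.sum_congr rfl fun i _ => Finset.sum_congr rfl fun j _ => ?_
    rw [real_inner_comm (y i) (y j)]
    ring
  rw [← hq, ht]
  by_cases hdet : IsUnit G.det
  · rw [hw, Matrix.mulVec_mulVec, Matrix.mul_nonsing_inv G hdet, Matrix.one_mulVec, dotProduct_comm]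
  -- For singular `G` the inverse is `0` by convention, hence `w = 0` and both sides vanish.
  · rw [hw, Matrix.nonsing_inv_apply_not_isUnit G hdet]
    simp

theorem leverageRatio_nonneg (g : E) (y : κ → E) : 0 ≤ leverageRatio g y := by
  obtain ⟨v, -, -, h⟩ := leverageRatio_eq_norm g y
  rw [h, ← mul_pow, sub_nonneg, sq_le_sq, abs_of_nonneg (a := ‖g‖ * ‖v‖) (by positivity), mul_comm]
  exact abs_real_inner_le_norm v g

/-- If the `q l` are orthonormal, and for `l ∈ T` orthogonal to the columns, then the leverage
ratio is at most `‖g‖² / ∑_{l ∈ T} ⟪q l, g⟫²`. -/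
theorem leverageRatio_mul_le {ι : Type*} [Fintype ι] (q : OrthonormalBasis ι ℝ E) (T : Finset ι)
    (g : E) (y : κ → E) (hq : ∀ l ∈ T, ∀ j, ⟪q l, y j⟫ = 0) :
    (1 + leverageRatio g y) * ∑ l ∈ T, ⟪q l, g⟫ ^ 2 ≤ ‖g‖ ^ 2 := by
  obtain ⟨v, hv, h1, h2⟩ := leverageRatio_eq_norm g y
  have h0 := leverageRatio_nonneg g y
  set t := leverageRatio g y
  have hqv : ∀ l ∈ T, ⟪q l, v⟫ = 0 := by
    intro l hl
    clear h1 h2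
    induction hv using Submodule.span_induction with
    | mem x hx => obtain ⟨j, rfl⟩ := hx; exact hq l hl j
    | zero => simp
    | add x z _ _ hx hz => rw [inner_add_right, hx, hz, add_zero]
    | smul c x _ hx => rw [inner_smul_right, hx, mul_zero]
  -- For invertible `G`, `lam • v` is the orthogonal projection of `g` onto the span of the columns.
  -- In every case the squared residual is `‖g‖² / (1 + t)`, and the residual has the same
  -- coordinates as `g` along `q l`, `l ∈ T`.
  set lam := ‖g‖ ^ 2 / (1 + t)
  have hd : ∑ l ∈ T, ⟪q l, g⟫ ^ 2 ≤ ‖g - lam • v‖ ^ 2 := by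
    rw [← q.sum_sq_inner_right]
    calc ∑ l ∈ T, ⟪q l, g⟫ ^ 2 = ∑ l ∈ T, ⟪q l, g - lam • v⟫ ^ 2 := by
          refine Finset.sum_congr rfl fun l hl => ?_
          rw [inner_sub_right, inner_smul_right, hqv l hl, mul_zero, sub_zero]
      _ ≤ _ := Finset.sum_le_univ_sum_of_nonneg fun l => sq_nonneg _
  have he : ‖g - lam • v‖ ^ 2 = ‖g‖ ^ 2 - 2 * lam * t + lam ^ 2 * ‖v‖ ^ 2 := by
    rw [norm_sub_sq_real, inner_smul_right, real_inner_comm, h1, norm_smul, mul_pow,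
      Real.norm_eq_abs, sq_abs]
    ring
  have hl : lam * (1 + t) = ‖g‖ ^ 2 := div_mul_cancel₀ _ (by positivity)
  have hs : ‖g‖ ^ 2 * ‖v‖ ^ 2 = t * (1 + t) := by rw [h1] at h2; linear_combination -h2
  have h3 : lam * ‖v‖ ^ 2 = t := by
    have : (1 + t) * (lam * ‖v‖ ^ 2) = (1 + t) * t := by
      linear_combination ‖v‖ ^ 2 * hl + hs
    exact mul_left_cancel₀ (by positivity) this
  calc (1 + t) * ∑ l ∈ T, ⟪q l, g⟫ ^ 2 ≤ (1 + t) * ‖g - lam • v‖ ^ 2 := by gcongr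
    _ = ‖g‖ ^ 2 := by rw [he]; linear_combination (-(t : ℝ)) * hl + lam * (1 + t) * h3

end

/-- With `a` the vector of column sums, `x̄ = a / n` and `n (n - 1) Σ̂ = G`. For `n ≤ 1` both sides
are `0`. -/
theorem hotellingTSq_eq_leverageRatio {n : ℕ} {κ : Type*} [Fintype κ] [DecidableEq κ]
    (x : Fin n → κ → ℝ) :
    hotellingTSq x = ((n : ℝ) - 1) * leverageRatio (WithLp.toLp 2 fun _ => (1 : ℝ))
      (fun j => (WithLp.toLp 2 fun i => x i j : EuclideanSpace ℝ (Fin n))) := by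
  rcases Nat.eq_zero_or_pos n with rfl | hn
  · simp [hotellingTSq, leverageRatio, PiLp.inner_apply]
  by_cases hn1 : n = 1
  · subst hn1
    simp [hotellingTSq, sampleCov]
  have hn0 : (n : ℝ) ≠ 0 := by positivity
  have hn1' : (n : ℝ) - 1 ≠ 0 := by
    rw [sub_ne_zero]; exact_mod_cast hn1
  set a : κ → ℝ := fun j => ∑ i, x i j with ha
  set G : Matrix κ κ ℝ := Matrix.of fun j l => n * ∑ i, x i j * x i l - a j * a l with hG
  have hmean : sampleMean x = (n : ℝ)⁻¹ • a := by
    ext j; simp [sampleMean, ha]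
  have hcov : sampleCov x = (((n : ℝ) - 1) * n)⁻¹ • G := by
    ext j l
    simp only [sampleCov, hmean, Matrix.smul_apply, Matrix.sum_apply, Matrix.vecMulVec_apply,
      Pi.sub_apply, Pi.smul_apply, smul_eq_mul, hG, Matrix.of_apply]
    have : ∑ i, (x i j - (n : ℝ)⁻¹ * a j) * (x i l - (n : ℝ)⁻¹ * a l)
        = ∑ i, x i j * x i l - (n : ℝ)⁻¹ * a j * a l := by
      simp only [sub_mul, mul_sub, Finset.sum_sub_distrib, ← Finset.mul_sum, ← Finset.sum_mul]
      simp only [Finset.sum_const, Finset.card_univ, Fintype.card_fin, nsmul_eq_mul]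
      change _ - _ * a l - (a j * _ - _) = _
      field_simp
      ring
    rw [this]
    field_simp
  have hlev : leverageRatio (WithLp.toLp 2 fun _ => (1 : ℝ))
      (fun j => (WithLp.toLp 2 fun i => x i j : EuclideanSpace ℝ (Fin n))) = a ⬝ᵥ (G⁻¹ *ᵥ a) := by
    simp [leverageRatio, PiLp.inner_apply, EuclideanSpace.norm_sq_eq, hG, ha, mul_comm]
  rw [hlev, hotellingTSq, hmean, hcov, inv_smul_of_ne_zero _ (by positivity)]
  simp only [Matrix.smul_mulVec, Matrix.mulVec_smul, dotProduct_smul, smul_dotProduct, smul_eq_mul]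
  field_simp

/-! ### Measurability -/

theorem measurable_inv_apply {α κ : Type*} [MeasurableSpace α] [Fintype κ] [DecidableEq κ]
    {M : α → Matrix κ κ ℝ} (hM : ∀ i j, Measurable fun x => M x i j) (i j : κ) :
    Measurable fun x => (M x)⁻¹ i j := by
  have hdet : ∀ {N : α → Matrix κ κ ℝ}, (∀ i j, Measurable fun x => N x i j) →
      Measurable fun x => (N x).det := by
    intro N hN
    simp only [Matrix.det_apply]
    fun_prop
  simp only [Matrix.inv_def, Matrix.smul_apply, smul_eq_mul, Ring.inverse_eq_inv',
    Matrix.adjugate_apply]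
  refine (hdet hM).inv.mul (hdet fun l m => ?_)
  by_cases h : l = j
  · subst h; simp
  · simpa [Matrix.updateRow_ne h] using hM l m

theorem measurable_leverageRatio {κ E : Type*} [Fintype κ] [DecidableEq κ] [NormedAddCommGroup E]
    [InnerProductSpace ℝ E] [MeasurableSpace E] [BorelSpace E] [SecondCountableTopology E] :
    Measurable fun q : E × (κ → E) => leverageRatio q.1 q.2 := by
  unfold leverageRatio dotProduct Matrix.mulVec dotProduct
  refine Finset.measurable_sum _ fun i _ => Measurable.mul (by fun_prop)
    (Finset.measurable_sum _ fun j _ => Measurable.mul (measurable_inv_apply (fun l m => ?_) i j)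
      (by fun_prop))
  simp only [Matrix.of_apply]
  fun_prop

theorem measurable_hotellingTSq {n : ℕ} {κ : Type*} [Fintype κ] [DecidableEq κ] :
    Measurable fun x : Fin n → κ → ℝ => hotellingTSq x := by
  simp only [hotellingTSq_eq_leverageRatio]
  refine Measurable.const_mul (measurable_leverageRatio.comp (measurable_const.prodMk ?_)) _
  fun_prop

/-! ### Second moment of the leverage ratio -/

theorem integrable_abs_rpow_mul_exp_neg_mul_sq {b s : ℝ} (hb : 0 < b) (hs : -1 < s) :
    Integrable fun x : ℝ => |x| ^ s * Real.exp (-b * x ^ 2) := by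
  have h : IntegrableOn (fun x : ℝ => |x| ^ s * Real.exp (-b * x ^ 2)) (Set.Ioi 0) := by
    refine (integrableOn_rpow_mul_exp_neg_mul_sq hb hs).congr_fun (fun x hx => ?_)
      measurableSet_Ioi
    simp only [abs_of_pos (Set.mem_Ioi.1 hx)]
  rw [← integrableOn_univ, ← @Set.Iio_union_Ici _ _ (0 : ℝ), integrableOn_union,
    integrableOn_Ici_iff_integrableOn_Ioi]
  refine ⟨?_, h⟩
  rw [← (Measure.measurePreserving_neg (volume : Measure ℝ)).integrableOn_comp_preimage
      (Homeomorph.neg ℝ).measurableEmbedding]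
  simpa [Function.comp_def] using h

theorem integrable_abs_rpow_gaussianReal {s : ℝ} (hs : -1 < s) :
    Integrable (fun x : ℝ => |x| ^ s) (gaussianReal 0 1) := by
  rw [gaussianReal_of_var_ne_zero 0 one_ne_zero,
    integrable_withDensity_iff (measurable_gaussianPDF 0 1) (ae_of_all _ fun _ => gaussianPDF_lt_top)]
  simp only [toReal_gaussianPDF, gaussianPDFReal]
  refine ((integrable_abs_rpow_mul_exp_neg_mul_sq (b := 1 / 2) (by norm_num) hs).mul_const
    (√(2 * Real.pi))⁻¹).congr (ae_of_all _ fun x => ?_)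
  simp only [NNReal.coe_one, mul_one, sub_zero]
  rw [mul_assoc, mul_comm (Real.exp _)]
  congr 3
  ring

theorem integrable_one_add_sq_sq_mul_abs_rpow_gaussianReal {s : ℝ} (hs : -1 < s) :
    Integrable (fun x : ℝ => (1 + x ^ 2) ^ 2 * |x| ^ s) (gaussianReal 0 1) := by
  have h := ((integrable_abs_rpow_gaussianReal hs).add
    ((integrable_abs_rpow_gaussianReal (s := s + 2) (by linarith)).const_mul 2)).add
    (integrable_abs_rpow_gaussianReal (s := s + 4) (by linarith))
  refine h.congr ?_
  have := nullSingletonClass_gaussianReal (μ := 0) (one_ne_zero (α := NNReal))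
  filter_upwards [measure_eq_zero_iff_ae_notMem.1 (measure_singleton (μ := gaussianReal 0 1) 0)]
    with x hx
  have hx : 0 < |x| := abs_pos.2 hx
  simp only [Pi.add_apply]
  rw [Real.rpow_add hx, Real.rpow_add hx, ← sq_abs x, Real.rpow_ofNat, Real.rpow_ofNat]
  ring

/-- There is an orthonormal basis whose first `r` vectors are orthogonal to `k` given vectors. -/
theorem exists_orthonormalBasis_orthogonal {n k r : ℕ} (h : k + r ≤ n)
    (y : Fin k → EuclideanSpace ℝ (Fin n)) :
    ∃ q : OrthonormalBasis (Fin n) ℝ (EuclideanSpace ℝ (Fin n)),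
      ∀ l : Fin n, (l : ℕ) < r → ∀ j, ⟪q l, y j⟫ = 0 := by
  set V := Submodule.span ℝ (Set.range y)
  have hV : Module.finrank ℝ V ≤ k := (finrank_range_le_card (R := ℝ) y).trans_eq (by simp)
  have hVo : r ≤ Module.finrank ℝ Vᗮ := by
    have := V.finrank_add_finrank_orthogonal
    simp at this
    omega
  set b := stdOrthonormalBasis ℝ Vᗮ
  let v : Fin n → EuclideanSpace ℝ (Fin n) := fun i =>
    if hi : (i : ℕ) < r then (b ⟨i, hi.trans_le hVo⟩ : EuclideanSpace ℝ (Fin n)) else 0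
  have hv : Orthonormal ℝ (({i : Fin n | (i : ℕ) < r} : Set (Fin n)).domRestrict v) := by
    have h1 : Orthonormal ℝ fun i => (b i : EuclideanSpace ℝ (Fin n)) :=
      b.orthonormal.comp_linearIsometry Vᗮ.subtypeₗᵢ
    have h2 := h1.comp (fun i : ({i : Fin n | (i : ℕ) < r} : Set (Fin n)) =>
      (⟨i.1, lt_of_lt_of_le i.2 hVo⟩ : Fin _)) (by
        intro i j hij
        simpa [Subtype.ext_iff, Fin.ext_iff] using hij)
    convert h2 using 1
    ext1 i
    have hi : ((i : Fin n) : ℕ) < r := i.2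
    simp [v, hi, Set.domRestrict]
  obtain ⟨q, hq⟩ := hv.exists_orthonormalBasis_extension_of_card_eq (by simp)
  refine ⟨q, fun l hl j => ?_⟩
  rw [hq l hl]
  simp only [v, hl, dif_pos]
  rw [real_inner_comm]
  exact (b _).2 _ (Submodule.subset_span ⟨j, rfl⟩)

/-- A bound by a product over coordinates reduces integrability to one dimension. Splitting `d⁻²`
over eight coordinates costs only `|x i| ^ (-1/2)` each, integrable at `0`; any number of
coordinates above four would do. -/
theorem div_sum_sq_sq_le {ι : Type*} [Fintype ι] [DecidableEq ι] {T : Finset ι} (hT : T.card = 8) {x : ι → ℝ}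
    (hx : ∀ i, x i ≠ 0) :
    ((∑ i, x i ^ 2) / ∑ i ∈ T, x i ^ 2) ^ 2 ≤
      ∏ i, ((1 + x i ^ 2) ^ 2 * |x i| ^ (if i ∈ T then (-1 / 2 : ℝ) else 0)) := by
  have h1 : ∑ i, x i ^ 2 ≤ ∏ i, (1 + x i ^ 2) := by
    have h : ∀ s : Finset ι, 1 + ∑ i ∈ s, x i ^ 2 ≤ ∏ i ∈ s, (1 + x i ^ 2) := by
      intro s
      induction s using Finset.induction_on with
      | empty => simp
      | insert i s hi ih =>
        rw [Finset.sum_insert hi, Finset.prod_insert hi]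
        nlinarith [sq_nonneg (x i), Finset.sum_nonneg fun i (_ : i ∈ s) => sq_nonneg (x i)]
    linarith [h Finset.univ]
  set d := ∑ i ∈ T, x i ^ 2
  have hd : 0 < d := by
    refine Finset.sum_pos (fun i _ => by have := hx i; positivity) ?_
    rw [← Finset.card_pos, hT]; norm_num
  have h2 : (d ^ 2)⁻¹ ≤ ∏ i ∈ T, |x i| ^ (-1 / 2 : ℝ) := by
    have h3 : ∀ i ∈ T, d ^ (-1 / 4 : ℝ) ≤ |x i| ^ (-1 / 2 : ℝ) := by
      intro i hi
      have h4 : |x i| ^ (-1 / 2 : ℝ) = (x i ^ 2) ^ (-1 / 4 : ℝ) := by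
        rw [← sq_abs, ← Real.rpow_natCast, ← Real.rpow_mul (abs_nonneg _)]
        norm_num
      rw [h4]
      refine Real.rpow_le_rpow_of_nonpos (by have := hx i; positivity) ?_ (by norm_num)
      exact Finset.single_le_sum (f := fun i => x i ^ 2) (fun i _ => sq_nonneg _) hi
    calc (d ^ 2)⁻¹ = ∏ i ∈ T, d ^ (-1 / 4 : ℝ) := by
          rw [Finset.prod_const, hT, ← Real.rpow_natCast, ← Real.rpow_natCast,
            ← Real.rpow_neg hd.le, ← Real.rpow_mul hd.le]
          norm_num
      _ ≤ _ := Finset.prod_le_prod (fun i _ => by positivity) h3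
  rw [Finset.prod_mul_distrib, Finset.prod_pow, div_pow, div_eq_mul_inv]
  have h5 : ∏ i, |x i| ^ (if i ∈ T then (-1 / 2 : ℝ) else 0) = ∏ i ∈ T, |x i| ^ (-1 / 2 : ℝ) := by
    rw [← Finset.univ_inter T, ← Finset.prod_ite_mem]
    refine Finset.prod_congr rfl fun i _ => ?_
    by_cases hi : i ∈ T <;> simp [hi]
  rw [h5]
  gcongr

/-- The square of the leverage ratio of a Gaussian vector with respect to at most `n - 8` fixed
columns has a finite integral, bounded uniformly in the columns. -/
theorem exists_lintegral_leverageRatio_sq_le {n k : ℕ} (h : k + 8 ≤ n) :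
    ∃ C : ℝ≥0∞, C < ∞ ∧ ∀ y : Fin k → EuclideanSpace ℝ (Fin n),
      ∫⁻ g, ENNReal.ofReal (leverageRatio g y ^ 2) ∂(stdGaussian (EuclideanSpace ℝ (Fin n))) ≤ C := by
  set T : Finset (Fin n) := Finset.univ.filter fun l => (l : ℕ) < 8 with hT
  have hTc : T.card = 8 := by
    rw [hT, Fin.card_filter_val_lt]; omega
  set φ : Fin n → ℝ → ℝ := fun i x => (1 + x ^ 2) ^ 2 * |x| ^ (if i ∈ T then (-1 / 2 : ℝ) else 0)
  have hφ : Integrable (fun x : Fin n → ℝ => ∏ i, φ i (x i))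
      (Measure.pi fun _ => gaussianReal 0 1) := by
    refine Integrable.fintype_prod fun i => ?_
    apply integrable_one_add_sq_sq_mul_abs_rpow_gaussianReal
    split_ifs <;> norm_num
  refine ⟨∫⁻ x, ENNReal.ofReal (∏ i, φ i (x i)) ∂(Measure.pi fun _ : Fin n => gaussianReal 0 1),
    hφ.lintegral_lt_top, fun y => ?_⟩
  obtain ⟨q, hq⟩ := exists_orthonormalBasis_orthogonal h y
  have hm : Measurable fun g => ENNReal.ofReal (leverageRatio g y ^ 2) :=
    ((measurable_leverageRatio.comp (measurable_id.prodMk measurable_const)).pow_const 2).ennreal_ofReal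
  rw [stdGaussian_eq_map_pi_orthonormalBasis q, lintegral_map hm (by fun_prop)]
  refine lintegral_mono_ae ?_
  have hne : ∀ᵐ x ∂(Measure.pi fun _ : Fin n => gaussianReal 0 1), ∀ i, x i ≠ 0 := by
    rw [ae_all_iff]
    intro i
    have := nullSingletonClass_gaussianReal (μ := 0) (one_ne_zero (α := NNReal))
    exact (Measure.quasiMeasurePreserving_eval (fun _ : Fin n => gaussianReal 0 1) i).ae
      (measure_eq_zero_iff_ae_notMem.1 (measure_singleton (μ := gaussianReal 0 1) 0))
  filter_upwards [hne] with x hx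
  refine ENNReal.ofReal_le_ofReal (le_trans ?_ (div_sum_sq_sq_le hTc hx))
  have hin : ∀ l, ⟪q l, ∑ i, x i • q i⟫ = x l := fun l => by
    rw [inner_sum, Finset.sum_eq_single l]
    · simp [inner_smul_right]
    · intro i _ hi
      rw [inner_smul_right, q.orthonormal.inner_eq_zero hi.symm, mul_zero]
    · simp
  have hle := leverageRatio_mul_le q T (∑ i, x i • q i) y
    (fun l hl => hq l (by simpa [hT] using hl))
  have hnorm : ‖∑ i, x i • q i‖ ^ 2 = ∑ i, x i ^ 2 := by
    rw [← q.sum_sq_inner_right]; simp only [hin]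
  simp only [hin, hnorm] at hle
  have hd : 0 < ∑ i ∈ T, x i ^ 2 := by
    refine Finset.sum_pos (fun i _ => by have := hx i; positivity) ?_
    rw [← Finset.card_pos, hTc]; norm_num
  have h0 := leverageRatio_nonneg (∑ i, x i • q i) y
  refine pow_le_pow_left₀ h0 ?_ 2
  rw [le_div_iff₀ hd]
  nlinarith

theorem map_pi_stdGaussian {κ E : Type*} [Fintype κ] [NormedAddCommGroup E]
    [InnerProductSpace ℝ E] [FiniteDimensional ℝ E] [MeasurableSpace E] [BorelSpace E]
    (O : E ≃ₗᵢ[ℝ] E) :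
    (Measure.pi fun _ : κ => stdGaussian E).map (fun y j => O (y j)) =
      Measure.pi fun _ => stdGaussian E := by
  have hO := stdGaussian_map O
  have : ∀ _ : κ, SigmaFinite ((stdGaussian E).map O) := fun _ => by rw [hO]; infer_instance
  rw [Measure.pi_map_pi (fun _ => by fun_prop)]
  simp only [hO]

theorem ae_ne_zero_stdGaussian {E : Type*} [NormedAddCommGroup E]
    [InnerProductSpace ℝ E] [FiniteDimensional ℝ E] [MeasurableSpace E] [BorelSpace E]
    {e : E} (he : e ≠ 0) : ∀ᵐ g ∂(stdGaussian E), g ≠ 0 := by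
  -- A Gaussian measure with an atom is a Dirac mass, but the variance along `e` is `‖e‖² ≠ 0`.
  have : NullSingletonClass (stdGaussian E) := IsGaussian.nullSingletonClass fun x hx => by
    have h := variance_dual_stdGaussian (innerSL ℝ e)
    rw [hx, variance_dirac] at h
    have h' : 0 = ‖e‖ ^ 2 := by simpa using h
    exact he (norm_eq_zero.1 (pow_eq_zero_iff two_ne_zero |>.1 h'.symm))
  exact measure_eq_zero_iff_ae_notMem.1 (measure_singleton (μ := stdGaussian E) 0)

theorem memLp_leverageRatio_pi_stdGaussian {n k : ℕ} (h : k + 8 ≤ n)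
    {e : EuclideanSpace ℝ (Fin n)} (he : e ≠ 0) :
    MemLp (fun y : Fin k → EuclideanSpace ℝ (Fin n) => leverageRatio e y) 2
      (Measure.pi fun _ => stdGaussian (EuclideanSpace ℝ (Fin n))) := by
  set μ := stdGaussian (EuclideanSpace ℝ (Fin n)) with hμ
  set π := Measure.pi fun _ : Fin k => μ
  have hmeas : Measurable fun q : EuclideanSpace ℝ (Fin n) × (Fin k → EuclideanSpace ℝ (Fin n)) =>
      ENNReal.ofReal (leverageRatio q.1 q.2 ^ 2) :=
    (measurable_leverageRatio.pow_const 2).ennreal_ofReal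
  have hm : ∀ g : EuclideanSpace ℝ (Fin n),
      Measurable fun y : Fin k → EuclideanSpace ℝ (Fin n) => leverageRatio g y := fun g =>
    measurable_leverageRatio.comp (measurable_const.prodMk measurable_id)
  have hconst : ∀ g : EuclideanSpace ℝ (Fin n), g ≠ 0 →
      ∫⁻ y, ENNReal.ofReal (leverageRatio g y ^ 2) ∂π
        = ∫⁻ y, ENNReal.ofReal (leverageRatio e y ^ 2) ∂π := by
    intro g hg
    set c := ‖g‖ / ‖e‖ with hc
    have hc0 : c ≠ 0 := by positivity
    have hn : ‖c • e‖ = ‖g‖ := by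
      rw [norm_smul, hc, Real.norm_eq_abs, abs_of_nonneg (by positivity)]
      field_simp
    -- This reflection carries the rescaled `e` to `g` and preserves the law of the columns, so the
    -- second moment is the same for every nonzero `g`.
    set O := (ℝ ∙ (c • e - g))ᗮ.reflection
    have hO : O (c • e) = g := Submodule.reflection_sub hn
    have hmap : π.map (fun y j => O (y j)) = π := map_pi_stdGaussian O
    calc ∫⁻ y, ENNReal.ofReal (leverageRatio g y ^ 2) ∂π
        = ∫⁻ y, ENNReal.ofReal (leverageRatio g y ^ 2) ∂(π.map (fun y j => O (y j))) := by rw [hmap]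
      _ = ∫⁻ y, ENNReal.ofReal (leverageRatio g (fun j => O (y j)) ^ 2) ∂π :=
          lintegral_map ((hm g).pow_const 2).ennreal_ofReal (by fun_prop)
      _ = _ := by
          refine lintegral_congr fun y => ?_
          rw [← hO, leverageRatio_map, leverageRatio_smul hc0]
  obtain ⟨C, hC, hle⟩ := exists_lintegral_leverageRatio_sq_le h
  have hfin : ∫⁻ y, ENNReal.ofReal (leverageRatio e y ^ 2) ∂π ≤ C := by
    -- Being constant in `g`, the moment equals its Gaussian average; Tonelli then integrates over
    -- `g` first, where the bound is uniform in the columns.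
    calc ∫⁻ y, ENNReal.ofReal (leverageRatio e y ^ 2) ∂π
        = ∫⁻ _, ∫⁻ y, ENNReal.ofReal (leverageRatio e y ^ 2) ∂π ∂μ := by simp
      _ = ∫⁻ g, ∫⁻ y, ENNReal.ofReal (leverageRatio g y ^ 2) ∂π ∂μ := by
          refine lintegral_congr_ae ?_
          filter_upwards [ae_ne_zero_stdGaussian he] with g hg
          exact (hconst g hg).symm
      _ = ∫⁻ y, ∫⁻ g, ENNReal.ofReal (leverageRatio g y ^ 2) ∂μ ∂π :=
          lintegral_lintegral_swap hmeas.aemeasurable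
      _ ≤ ∫⁻ _, C ∂π := lintegral_mono hle
      _ = C := by simp
  rw [memLp_two_iff_integrable_sq (hm e).aestronglyMeasurable]
  refine ⟨((hm e).pow_const 2).aestronglyMeasurable, ?_⟩
  rw [hasFiniteIntegral_iff_ofReal (ae_of_all _ fun _ => sq_nonneg _)]
  exact hfin.trans_lt hC

/-! ### Gaussian coordinates and the coupling -/

theorem charFunDual_pi_gaussianReal {κ : Type*} [Fintype κ] [DecidableEq κ]
    (L : StrongDual ℝ (κ → ℝ)) :
    charFunDual (Measure.pi fun _ : κ => gaussianReal 0 1) L =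
      Complex.exp (-((∑ i, L (Pi.single i 1) ^ 2 : ℝ) : ℂ) / 2) := by
  rw [charFunDual_pi]
  have h : ∀ M : StrongDual ℝ ℝ, charFunDual (gaussianReal 0 1) M =
      Complex.exp (-((M 1 ^ 2 : ℝ) : ℂ) / 2) := by
    intro M
    have := charFun_gaussianReal (μ := 0) (v := 1) (M 1)
    rw [charFun_apply_real] at this
    rw [charFunDual_apply]
    have hM : ∀ x, M x = M 1 * x := fun x => by
      conv_lhs => rw [← mul_one x, ← smul_eq_mul, map_smul, smul_eq_mul, mul_comm]
    rw [show (∫ x, Complex.exp (M x * Complex.I) ∂(gaussianReal 0 1)) =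
      ∫ x, Complex.exp (M 1 * x * Complex.I) ∂(gaussianReal 0 1) from
        integral_congr_ae (ae_of_all _ fun x => by simp only [hM x]; push_cast; rfl), this]
    congr 1
    simp
    ring
  simp only [h, ← Complex.exp_sum]
  congr 1
  push_cast
  rw [← Finset.sum_div, Finset.sum_neg_distrib]
  simp

theorem charFunDual_stdGaussian_innerSL {E : Type*} [NormedAddCommGroup E] [InnerProductSpace ℝ E]
    [FiniteDimensional ℝ E] [MeasurableSpace E] [BorelSpace E] {L : StrongDual ℝ E} {a : E}
    (h : ∀ g, L g = ⟪a, g⟫) :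
    charFunDual (stdGaussian E) L = Complex.exp (-((‖a‖ ^ 2 : ℝ) : ℂ) / 2) := by
  have : L = innerSL ℝ a := by ext g; simp [h]
  rw [charFunDual_stdGaussian, this, innerSL_apply_norm]
  norm_cast

section

variable {E : Type*} [NormedAddCommGroup E] [InnerProductSpace ℝ E] [FiniteDimensional ℝ E]
  [MeasurableSpace E] [BorelSpace E] {κ : Type*} [Fintype κ] [DecidableEq κ]

theorem strongDual_pi_apply (L : StrongDual ℝ (κ → ℝ)) (x : κ → ℝ) :
    L x = ∑ i, x i * L (Pi.single i 1) := by
  conv_lhs => rw [pi_eq_sum_univ' x, map_sum]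
  refine Finset.sum_congr rfl fun i _ => ?_
  rw [map_smul, smul_eq_mul]

theorem map_inner_stdGaussian {u : κ → E} (hu : Orthonormal ℝ u) :
    (stdGaussian E).map (fun g j => ⟪u j, g⟫) = Measure.pi fun _ => gaussianReal 0 1 := by
  let A : E →L[ℝ] (κ → ℝ) := ContinuousLinearMap.pi fun j => innerSL ℝ (u j)
  change (stdGaussian E).map A = _
  apply Measure.ext_of_charFunDual
  ext L
  rw [charFunDual_map, charFunDual_pi_gaussianReal,
    charFunDual_stdGaussian_innerSL (a := ∑ j, L (Pi.single j 1) • u j)]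
  · rw [← real_inner_self_eq_norm_sq, hu.inner_sum]
    simp [sq]
  · intro g
    rw [ContinuousLinearMap.comp_apply, strongDual_pi_apply]
    simp [A, sum_inner, inner_smul_left, mul_comm]

/-- If `u` and `v` are orthonormal with `⟪u i, v j⟫ = ρ i δ i j` and `0 ≤ ρ`, then the coordinates
of a Gaussian vector along `u` and along `v` arise from a common Gaussian vector by adding
independent copies of the same Gaussian noise. -/
theorem map_inner_prod_stdGaussian {u v : κ → E} (hu : Orthonormal ℝ u) (hv : Orthonormal ℝ v)
    {ρ : κ → ℝ} (hρ : ∀ i, 0 ≤ ρ i) (huv : ∀ i j, ⟪u i, v j⟫ = if i = j then ρ i else 0) :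
    (stdGaussian E).map (fun g => ((fun j => ⟪u j, g⟫), fun j => ⟪v j, g⟫)) =
      ((Measure.pi fun _ : κ => gaussianReal 0 1).prod
        ((Measure.pi fun _ : κ => gaussianReal 0 1).prod
          (Measure.pi fun _ : κ => gaussianReal 0 1))).map
        (fun q => ((fun j => √(ρ j) * q.1 j + √(1 - ρ j) * q.2.1 j),
          fun j => √(ρ j) * q.1 j + √(1 - ρ j) * q.2.2 j)) := by
  have hρ1 : ∀ i, ρ i ≤ 1 := fun i => by
    have := real_inner_le_norm (u i) (v i)
    simpa [huv, hu.1, hv.1] using this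
  let A : E →L[ℝ] (κ → ℝ) × (κ → ℝ) := (ContinuousLinearMap.pi fun j => innerSL ℝ (u j)).prod
    (ContinuousLinearMap.pi fun j => innerSL ℝ (v j))
  let B : (κ → ℝ) × (κ → ℝ) × (κ → ℝ) →L[ℝ] (κ → ℝ) × (κ → ℝ) :=
    LinearMap.toContinuousLinearMap
      { toFun := fun q => ((fun j => √(ρ j) * q.1 j + √(1 - ρ j) * q.2.1 j),
          fun j => √(ρ j) * q.1 j + √(1 - ρ j) * q.2.2 j)
        map_add' := fun x y => by ext j <;> simp <;> ring
        map_smul' := fun c x => by ext j <;> simp <;> ring }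
  change (stdGaussian E).map A = Measure.map B _
  apply Measure.ext_of_charFunDual
  ext L
  set s : κ → ℝ := fun j => L (Pi.single j 1, 0) with hs
  set t : κ → ℝ := fun j => L (0, Pi.single j 1) with ht
  have hL : ∀ x y : κ → ℝ, L (x, y) = ∑ j, x j * s j + ∑ j, y j * t j := by
    intro x y
    have h1 := strongDual_pi_apply (L ∘SL ContinuousLinearMap.inl ℝ (κ → ℝ) (κ → ℝ)) x
    have h2 := strongDual_pi_apply (L ∘SL ContinuousLinearMap.inr ℝ (κ → ℝ) (κ → ℝ)) y
    simp only [ContinuousLinearMap.comp_apply, ContinuousLinearMap.inl_apply,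
      ContinuousLinearMap.inr_apply] at h1 h2
    rw [← h1, ← h2, ← map_add]
    simp
  rw [charFunDual_map, charFunDual_map, charFunDual_prod, charFunDual_prod,
    charFunDual_pi_gaussianReal, charFunDual_pi_gaussianReal, charFunDual_pi_gaussianReal,
    charFunDual_stdGaussian_innerSL (a := ∑ j, s j • u j + ∑ j, t j • v j), ← Complex.exp_add,
    ← Complex.exp_add]
  · congr 1
    have h1 : ∀ c i, L (B (Pi.single i c, 0)) = √(ρ i) * (s i + t i) * c := by
      intro c i
      change L (_, _) = _
      rw [hL]
      simp [Pi.single_apply]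
      ring
    have h2 : ∀ c i, L (B (0, Pi.single i c, 0)) = √(1 - ρ i) * s i * c := by
      intro c i
      change L (_, _) = _
      rw [hL]
      simp [Pi.single_apply]
      ring
    have h3 : ∀ c i, L (B (0, 0, Pi.single i c)) = √(1 - ρ i) * t i * c := by
      intro c i
      change L (_, _) = _
      rw [hL]
      simp [Pi.single_apply]
      ring
    have hcross : ⟪∑ j, s j • u j, ∑ j, t j • v j⟫ = ∑ j, s j * t j * ρ j := by
      simp only [sum_inner, inner_sum, inner_smul_left, inner_smul_right, huv]
      simp [mul_comm, mul_left_comm]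
    -- The coupling has the right covariance: `ρ (s + t)² + (1 - ρ) (s² + t²) = s² + t² + 2 ρ s t`.
    have hnorm : ‖∑ j, s j • u j + ∑ j, t j • v j‖ ^ 2 =
        ∑ i, (√(ρ i) * (s i + t i)) ^ 2 + (∑ i, (√(1 - ρ i) * s i) ^ 2
          + ∑ i, (√(1 - ρ i) * t i) ^ 2) := by
      rw [norm_add_sq_real, hcross, ← real_inner_self_eq_norm_sq, ← real_inner_self_eq_norm_sq,
        hu.inner_sum, hv.inner_sum, Finset.mul_sum, ← Finset.sum_add_distrib,
        ← Finset.sum_add_distrib, ← Finset.sum_add_distrib, ← Finset.sum_add_distrib]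
      refine Finset.sum_congr rfl fun i _ => ?_
      simp only [mul_pow, Real.sq_sqrt (hρ i), Real.sq_sqrt (sub_nonneg.2 (hρ1 i)), conj_trivial]
      ring
    simp only [ContinuousLinearMap.comp_apply, ContinuousLinearMap.inl_apply,
      ContinuousLinearMap.inr_apply, h1, h2, h3, mul_one, hnorm]
    push_cast
    ring
  · intro g
    change L (_, _) = _
    rw [hL]
    simp [sum_inner, inner_smul_left, inner_add_left, mul_comm]

/-- Functions of the pairs `(w, z)` and `(w, z')`, with `z` and `z'` independent copies, have
nonnegative covariance if they are equal. -/
theorem covariance_prod_prod_nonneg {A B : Type*} [MeasurableSpace A] [MeasurableSpace B]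
    (μ : Measure A) (ν : Measure B) [IsProbabilityMeasure μ] [IsProbabilityMeasure ν]
    {f : A × B → ℝ} (hf : Measurable f) :
    0 ≤ cov[fun q => f (q.1, q.2.1), fun q => f (q.1, q.2.2); μ.prod (ν.prod ν)] := by
  have hswap : MeasurePreserving (fun q : A × B × B => (q.1, q.2.2, q.2.1)) (μ.prod (ν.prod ν))
      (μ.prod (ν.prod ν)) :=
    (MeasurePreserving.id μ).prod (Measure.measurePreserving_swap (μ := ν) (ν := ν))
  have hmean : ∫ q, f (q.1, q.2.2) ∂(μ.prod (ν.prod ν)) =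
      ∫ q, f (q.1, q.2.1) ∂(μ.prod (ν.prod ν)) := by
    conv_lhs => rw [← hswap.map_eq]
    rw [integral_map hswap.measurable.aemeasurable
      (Measurable.aestronglyMeasurable (by fun_prop))]
  unfold covariance
  rw [hmean]
  set c := ∫ q, f (q.1, q.2.1) ∂(μ.prod (ν.prod ν))
  by_cases hint : Integrable (fun q : A × B × B => (f (q.1, q.2.1) - c) * (f (q.1, q.2.2) - c))
      (μ.prod (ν.prod ν))
  -- For fixed `w` the inner integral factors into two equal integrals, hence is a square.
  · rw [integral_prod _ hint]
    refine integral_nonneg fun w => ?_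
    rw [integral_prod_mul (fun z => f (w, z) - c) (fun z => f (w, z) - c)]
    exact mul_self_nonneg _
  -- The Bochner integral of a non-integrable function is `0`.
  · rw [integral_undef hint]

theorem covariance_inner_nonneg {n : ℕ} {u v : κ → E} (hu : Orthonormal ℝ u)
    (hv : Orthonormal ℝ v) {ρ : κ → ℝ} (hρ : ∀ i, 0 ≤ ρ i)
    (huv : ∀ i j, ⟪u i, v j⟫ = if i = j then ρ i else 0)
    {F : (Fin n → κ → ℝ) → ℝ} (hF : Measurable F) :
    0 ≤ cov[fun g => F (fun i j => ⟪u j, g i⟫), fun g => F (fun i j => ⟪v j, g i⟫);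
      Measure.pi fun _ : Fin n => stdGaussian E] := by
  set γ := Measure.pi fun _ : κ => gaussianReal 0 1 with hγ
  set Γ := Measure.pi fun _ : Fin n => γ
  let a : E → (κ → ℝ) × (κ → ℝ) := fun g => ((fun j => ⟪u j, g⟫), fun j => ⟪v j, g⟫)
  let b : (κ → ℝ) × (κ → ℝ) × (κ → ℝ) → (κ → ℝ) × (κ → ℝ) := fun q =>
    ((fun j => √(ρ j) * q.1 j + √(1 - ρ j) * q.2.1 j),
      fun j => √(ρ j) * q.1 j + √(1 - ρ j) * q.2.2 j)
  have ha : Measurable a := by fun_prop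
  have hb : Measurable b := by fun_prop
  have hab : (stdGaussian E).map a = (γ.prod (γ.prod γ)).map b :=
    map_inner_prod_stdGaussian hu hv hρ huv
  have hpa : IsProbabilityMeasure ((stdGaussian E).map a) :=
    Measure.isProbabilityMeasure_map ha.aemeasurable
  have hpb : IsProbabilityMeasure ((γ.prod (γ.prod γ)).map b) :=
    Measure.isProbabilityMeasure_map hb.aemeasurable
  have hpi : (Measure.pi fun _ : Fin n => stdGaussian E).map (fun g i => a (g i)) =
      (Measure.pi fun _ : Fin n => γ.prod (γ.prod γ)).map (fun q i => b (q i)) := by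
    rw [Measure.pi_map_pi (fun _ => ha.aemeasurable), Measure.pi_map_pi (fun _ => hb.aemeasurable)]
    simp only [hab]
  -- Regroup `n` independent triples `(w, z, z')` into three independent samples, so that the shared
  -- parts of all observations are conditioned on at once.
  have h1 := measurePreserving_arrowProdEquivProdArrow (κ → ℝ) ((κ → ℝ) × (κ → ℝ)) (Fin n)
    (fun _ => γ) (fun _ => γ.prod γ)
  have h2 := measurePreserving_arrowProdEquivProdArrow (κ → ℝ) (κ → ℝ) (Fin n)
    (fun _ => γ) (fun _ => γ)
  have h3 := ((MeasurePreserving.id Γ).prod h2).comp h1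
  let f : (Fin n → κ → ℝ) × (Fin n → κ → ℝ) → ℝ := fun q =>
    F (fun i j => √(ρ j) * q.1 i j + √(1 - ρ j) * q.2 i j)
  have hf : Measurable f := hF.comp (by fun_prop)
  have hX : Measurable fun y : Fin n → (κ → ℝ) × (κ → ℝ) => F (fun i => (y i).1) :=
    hF.comp (by fun_prop)
  have hY : Measurable fun y : Fin n → (κ → ℝ) × (κ → ℝ) => F (fun i => (y i).2) :=
    hF.comp (by fun_prop)
  have key := covariance_prod_prod_nonneg Γ Γ hf
  rw [← h3.map_eq, covariance_map_fun (Measurable.aestronglyMeasurable (by fun_prop))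
    (Measurable.aestronglyMeasurable (by fun_prop)) h3.measurable.aemeasurable] at key
  have e1 := covariance_map_fun (μ := Measure.pi fun _ : Fin n => stdGaussian E)
    (Z := fun g i => a (g i)) hX.aestronglyMeasurable hY.aestronglyMeasurable
    (measurable_pi_lambda _ fun i => ha.comp (measurable_pi_apply i)).aemeasurable
  have e2 := covariance_map_fun (μ := Measure.pi fun _ : Fin n => γ.prod (γ.prod γ))
    (Z := fun g i => b (g i)) hX.aestronglyMeasurable hY.aestronglyMeasurable
    (measurable_pi_lambda _ fun i => hb.comp (measurable_pi_apply i)).aemeasurable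
  rw [hpi, e2] at e1
  exact key.trans_eq e1

/-- Observations are rows, whereas the leverage ratio takes columns; an array of i.i.d. entries may
be read either way. -/
theorem map_transpose_pi_gaussianReal {n : ℕ} :
    (Measure.pi fun _ : Fin n => Measure.pi fun _ : κ => gaussianReal 0 1).map
      (fun x j => (WithLp.toLp 2 fun i => x i j : EuclideanSpace ℝ (Fin n))) =
      Measure.pi fun _ : κ => stdGaussian (EuclideanSpace ℝ (Fin n)) := by
  let A : (Fin n → κ → ℝ) →L[ℝ] (κ → EuclideanSpace ℝ (Fin n)) :=
    LinearMap.toContinuousLinearMap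
      { toFun := fun x j => WithLp.toLp 2 fun i => x i j
        map_add' := fun x y => rfl
        map_smul' := fun c x => rfl }
  change Measure.map A _ = _
  apply Measure.ext_of_charFunDual
  ext L
  rw [charFunDual_map, charFunDual_pi, charFunDual_pi]
  simp only [charFunDual_pi_gaussianReal]
  have h : ∀ M : StrongDual ℝ (EuclideanSpace ℝ (Fin n)),
      charFunDual (stdGaussian (EuclideanSpace ℝ (Fin n))) M =
        Complex.exp (-((∑ i, M (EuclideanSpace.single i 1) ^ 2 : ℝ) : ℂ) / 2) := by
    intro M
    let C : (Fin n → ℝ) →L[ℝ] EuclideanSpace ℝ (Fin n) :=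
      (EuclideanSpace.equiv (Fin n) ℝ).symm.toContinuousLinearMap
    have hC : (Measure.pi fun _ : Fin n => gaussianReal 0 1).map C =
        stdGaussian (EuclideanSpace ℝ (Fin n)) := map_pi_eq_stdGaussian
    rw [← hC, charFunDual_map, charFunDual_pi_gaussianReal]
    rfl
  simp only [h, ← Complex.exp_sum]
  congr 1
  rw [← Finset.sum_div, ← Finset.sum_div, Finset.sum_neg_distrib, Finset.sum_neg_distrib]
  push_cast
  rw [Finset.sum_comm]
  congr 2
  refine Finset.sum_congr rfl fun j _ => Finset.sum_congr rfl fun i _ => ?_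
  congr 3
  refine congrArg L ?_
  ext l m
  change (Pi.single i (Pi.single j (1 : ℝ)) : Fin n → κ → ℝ) m l = _
  by_cases hl : l = j <;> by_cases hm : m = i
  · subst hl hm; simp
  · subst hl; simp [hm]
  · subst hm; simp [hl]
  · simp [hl, hm]

end

theorem memLp_hotellingTSq_pi_gaussianReal {n k : ℕ} (h : k + 8 ≤ n) :
    MemLp (fun x : Fin n → Fin k → ℝ => hotellingTSq x) 2
      (Measure.pi fun _ => Measure.pi fun _ => gaussianReal 0 1) := by
  have he : (WithLp.toLp 2 fun _ => (1 : ℝ) : EuclideanSpace ℝ (Fin n)) ≠ 0 := by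
    intro h0
    have := congrArg (fun v : EuclideanSpace ℝ (Fin n) => v ⟨0, by omega⟩) h0
    simp at this
  have hL := memLp_leverageRatio_pi_stdGaussian h he
  rw [← map_transpose_pi_gaussianReal] at hL
  simp only [hotellingTSq_eq_leverageRatio]
  exact (hL.comp_of_map (Measurable.aemeasurable (by fun_prop))).const_mul _

/-! ### Principal vectors and reduction to subspaces -/

open scoped MatrixOrder

/-- Singular value decomposition of a linear map between spaces of the same finite dimension. -/
theorem exists_orthonormalBasis_map_eq_smul {E F : Type*} [NormedAddCommGroup E]
    [InnerProductSpace ℝ E] [FiniteDimensional ℝ E] [NormedAddCommGroup F] [InnerProductSpace ℝ F]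
    [FiniteDimensional ℝ F] {k : ℕ} (hE : Module.finrank ℝ E = k) (hF : Module.finrank ℝ F = k)
    (T : E →ₗ[ℝ] F) :
    ∃ (v : OrthonormalBasis (Fin k) ℝ E) (u : OrthonormalBasis (Fin k) ℝ F) (ρ : Fin k → ℝ),
      (∀ i, 0 ≤ ρ i) ∧ ∀ i, T (v i) = ρ i • u i := by
  have hsym := T.isPositive_adjoint_comp_self.isSymmetric
  -- Eigenvectors of `T* T` have orthogonal images; the nonzero images are normalized and extended
  -- to a basis.
  set v := hsym.eigenvectorBasis hE
  have horth : ∀ i j, i ≠ j → ⟪T (v i), T (v j)⟫ = 0 := by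
    intro i j hij
    have h : ⟪(LinearMap.adjoint T ∘ₗ T) (v i), v j⟫ = ⟪T (v i), T (v j)⟫ := by
      rw [LinearMap.comp_apply, LinearMap.adjoint_inner_left]
    rw [← h, hsym.apply_eigenvectorBasis, inner_smul_left, v.orthonormal.inner_eq_zero hij,
      mul_zero]
  have hon : Orthonormal ℝ (({i | ‖T (v i)‖ ≠ 0} : Set (Fin k)).domRestrict
      fun i => ‖T (v i)‖⁻¹ • T (v i)) := by
    refine ⟨fun i => ?_, fun i j hij => ?_⟩
    · have hi : ‖T (v i)‖ ≠ 0 := i.2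
      rw [Set.domRestrict_apply, norm_smul, norm_inv, norm_norm, inv_mul_cancel₀ hi]
    · simp only [Set.domRestrict_apply, inner_smul_left, inner_smul_right]
      rw [horth _ _ (fun h => hij (Subtype.ext h))]
      simp
  obtain ⟨u, hu⟩ := hon.exists_orthonormalBasis_extension_of_card_eq (by simpa using hF)
  refine ⟨v, u, fun i => ‖T (v i)‖, fun i => norm_nonneg _, fun i => ?_⟩
  beta_reduce
  by_cases hi : ‖T (v i)‖ = 0
  · rw [hi, zero_smul, norm_eq_zero.1 hi]
  · rw [hu i hi, smul_smul, mul_inv_cancel₀ hi, one_smul]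

/-- Canonical bases (principal vectors) of two subspaces of the same dimension. -/
theorem exists_orthonormalBasis_inner_eq_ite {E : Type*} [NormedAddCommGroup E]
    [InnerProductSpace ℝ E] [FiniteDimensional ℝ E] {k : ℕ} {U V : Submodule ℝ E}
    (hU : Module.finrank ℝ U = k) (hV : Module.finrank ℝ V = k) :
    ∃ (u : OrthonormalBasis (Fin k) ℝ U) (v : OrthonormalBasis (Fin k) ℝ V) (ρ : Fin k → ℝ),
      (∀ i, 0 ≤ ρ i) ∧ ∀ i j, ⟪(u i : E), (v j : E)⟫ = if i = j then ρ i else 0 := by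
  obtain ⟨v, u, ρ, hρ, h⟩ := exists_orthonormalBasis_map_eq_smul hV hU
    (U.orthogonalProjectionOnto.toLinearMap ∘ₗ V.subtype)
  refine ⟨u, v, ρ, hρ, fun i j => ?_⟩
  have hj : U.orthogonalProjectionOnto (v j : E) = ρ j • u j := h j
  rw [← Submodule.inner_orthogonalProjectionOnto_eq_of_mem_left, hj, inner_smul_right,
    u.inner_eq_ite]
  by_cases hij : i = j <;> simp [hij]

/-- The Hotelling statistic of `(⟪b j, g i⟫)` depends only on the span of the `b j`. -/
theorem hotellingTSq_inner_eq {E : Type*} [NormedAddCommGroup E] [InnerProductSpace ℝ E] {k n : ℕ}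
    {b : Fin k → E} (hb : LinearIndependent ℝ b)
    (u : OrthonormalBasis (Fin k) ℝ (Submodule.span ℝ (Set.range b))) (g : Fin n → E) :
    hotellingTSq (fun i j => ⟪b j, g i⟫) = hotellingTSq (fun i j => ⟪(u j : E), g i⟫) := by
  set B := Module.Basis.span hb
  have hdet : IsUnit (u.toBasis.toMatrix B)ᵀ.det := by
    rw [Matrix.det_transpose]
    have := u.toBasis.invertibleToMatrix B
    exact Matrix.isUnit_det_of_invertible _
  rw [← hotellingTSq_mulVec hdet (fun i j => ⟪(u j : E), g i⟫)]
  congr 1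
  ext i j
  have h := congrArg (Subtype.val) (u.toBasis.sum_toMatrix_smul_self B j)
  have hB : (B j : E) = b j := congrArg Subtype.val (Module.Basis.span_apply hb j)
  rw [← hB, ← h]
  simp [sum_inner, inner_smul_left, Matrix.mulVec, dotProduct]

/-- For observations `C^{1/2} g i`, the Hotelling statistic over the coordinates in `S` is that of
the coordinates of the `g i` in any orthonormal basis of a certain subspace of dimension `|S|`. -/
theorem exists_submodule_hotellingTSq_eq {p k : ℕ} {C : Matrix (Fin p) (Fin p) ℝ}
    (hC : C.PosSemidef) {S : Finset (Fin p)} (hS : S.card = k)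
    (hpos : (principalSubmatrix C S).PosDef) :
    ∃ U : Submodule ℝ (EuclideanSpace ℝ (Fin p)), Module.finrank ℝ U = k ∧
      ∀ (u : OrthonormalBasis (Fin k) ℝ U) (n : ℕ) (g : Fin n → EuclideanSpace ℝ (Fin p)),
        hotellingTSq (fun i (j : S) => Matrix.toEuclideanCLM (𝕜 := ℝ) (CFC.sqrt C) (g i) j) =
          hotellingTSq (fun i j => ⟪(u j : EuclideanSpace ℝ (Fin p)), g i⟫) := by
  set M := CFC.sqrt C with hM
  have hMM : M * M = C := CFC.sqrt_mul_sqrt_self C hC.nonneg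
  have hMt : Mᵀ = M := by
    have h : star M = M := (CFC.sqrt_nonneg C).isSelfAdjoint
    rwa [Matrix.star_eq_conjTranspose, Matrix.conjTranspose_eq_transpose_of_trivial] at h
  let e : Fin k ≃ S := (S.orderIsoOfFin hS).toEquiv
  let b : Fin k → EuclideanSpace ℝ (Fin p) := fun j => WithLp.toLp 2 (M (e j))
  have hin : ∀ j g, ⟪b j, g⟫ = Matrix.toEuclideanCLM (𝕜 := ℝ) M g (e j) := by
    intro j g
    change _ = (M *ᵥ g) (e j)
    simp [b, PiLp.inner_apply, Matrix.mulVec, dotProduct, mul_comm]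
  -- The Gram matrix of the chosen rows of `C^{1/2}` is `Σ_S`, so positive definiteness gives their
  -- independence and the dimension `k`.
  have hgram : Matrix.gram ℝ b = (principalSubmatrix C S).submatrix e e := by
    ext i j
    rw [Matrix.gram_apply, hin]
    change (M *ᵥ M (e j)) (e i) = C (e i) (e j)
    rw [← hMM]
    simp only [Matrix.mul_apply, Matrix.mulVec, dotProduct]
    refine Finset.sum_congr rfl fun l _ => ?_
    rw [← congrFun (congrFun hMt l) (e j), Matrix.transpose_apply]
  have hb : LinearIndependent ℝ b := by
    apply Matrix.linearIndependent_of_posDef_gram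
    rw [hgram]
    exact hpos.submatrix e.injective
  refine ⟨Submodule.span ℝ (Set.range b), by simp [finrank_span_eq_card hb], fun u n g => ?_⟩
  rw [← hotellingTSq_inner_eq hb u g, ← hotellingTSq_reindex e]
  simp only [hin]

/-! ### Transfer to the given sample -/

theorem IsCenteredGaussianSample.hasLaw_pi {n p : ℕ} {Ω : Type*} [MeasurableSpace Ω]
    {P : Measure Ω} {C : Matrix (Fin p) (Fin p) ℝ} {X : Fin n → Ω → EuclideanSpace ℝ (Fin p)}
    (h : IsCenteredGaussianSample P C X) :
    HasLaw (fun ω i => X i ω)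
      ((Measure.pi fun _ : Fin n => stdGaussian (EuclideanSpace ℝ (Fin p))).map
        fun g i => Matrix.toEuclideanCLM (𝕜 := ℝ) (CFC.sqrt C) (g i)) P := by
  have hl := iIndepFun.hasLaw_pi h.hasLaw h.indep
  have hc : multivariateGaussian 0 C = (stdGaussian (EuclideanSpace ℝ (Fin p))).map
      fun g => Matrix.toEuclideanCLM (𝕜 := ℝ) (CFC.sqrt C) g := by
    simp [multivariateGaussian]
  have hp : IsProbabilityMeasure ((stdGaussian (EuclideanSpace ℝ (Fin p))).map
      fun g => Matrix.toEuclideanCLM (𝕜 := ℝ) (CFC.sqrt C) g) := by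
    rw [← hc]; infer_instance
  rw [Measure.pi_map_pi (fun _ => by fun_prop)]
  simpa only [hc] using hl

theorem measurable_hotellingTSq_restrict {n p : ℕ} (S : Finset (Fin p)) :
    Measurable fun x : Fin n → EuclideanSpace ℝ (Fin p) => hotellingTSq fun i (j : S) => x i j :=
  measurable_hotellingTSq.comp (by fun_prop)

theorem memLp_hotellingOn {n p k : ℕ} (hk : k + 8 ≤ n) {Ω : Type*} [MeasurableSpace Ω]
    {P : Measure Ω} {C : Matrix (Fin p) (Fin p) ℝ} {X : Fin n → Ω → EuclideanSpace ℝ (Fin p)}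
    (h : IsCenteredGaussianSample P C X) {S : Finset (Fin p)} (hS : S.card = k)
    (hpos : (principalSubmatrix C S).PosDef) : MemLp (hotellingOn S X) 2 P := by
  obtain ⟨U, hU, hUe⟩ := exists_submodule_hotellingTSq_eq h.posSemidef hS hpos
  let u : OrthonormalBasis (Fin k) ℝ U := (stdOrthonormalBasis ℝ U).reindex (finCongr hU)
  have hu : Orthonormal ℝ fun j => (u j : EuclideanSpace ℝ (Fin p)) :=
    u.orthonormal.comp_linearIsometry U.subtypeₗᵢ
  have hlaw := h.hasLaw_pi
  have hm := measurable_hotellingTSq_restrict (n := n) S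
  refine MemLp.comp_of_map (f := fun ω i => X i ω)
    (g := fun x : Fin n → EuclideanSpace ℝ (Fin p) => hotellingTSq fun i (j : S) => x i j)
    ?_ hlaw.aemeasurable
  rw [hlaw.map_eq, memLp_map_measure_iff hm.aestronglyMeasurable
    (Measurable.aemeasurable (by fun_prop))]
  change MemLp (fun g : Fin n → EuclideanSpace ℝ (Fin p) => hotellingTSq fun i (j : S) =>
    Matrix.toEuclideanCLM (𝕜 := ℝ) (CFC.sqrt C) (g i) j) 2 _
  simp only [hUe u]
  -- Coordinates along an orthonormal family are i.i.d. standard normal, so the law of `T²_S` does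
  -- not depend on `C`.
  have hmap := map_inner_stdGaussian hu
  have hp : IsProbabilityMeasure ((stdGaussian (EuclideanSpace ℝ (Fin p))).map
      fun g j => ⟪(u j : EuclideanSpace ℝ (Fin p)), g⟫) := by
    rw [hmap]; infer_instance
  have hpi : (Measure.pi fun _ : Fin n => stdGaussian (EuclideanSpace ℝ (Fin p))).map
      (fun g i j => ⟪(u j : EuclideanSpace ℝ (Fin p)), g i⟫) =
      Measure.pi fun _ => Measure.pi fun _ => gaussianReal 0 1 := by
    have h := Measure.pi_map_pi (ι := Fin n) (μ := fun _ => stdGaussian (EuclideanSpace ℝ (Fin p)))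
      (f := fun _ g j => ⟪(u j : EuclideanSpace ℝ (Fin p)), g⟫)
      (fun _ => Measurable.aemeasurable (by fun_prop))
    simpa only [hmap] using h
  have hL := memLp_hotellingTSq_pi_gaussianReal hk
  rw [← hpi] at hL
  exact hL.comp_of_map (Measurable.aemeasurable (by fun_prop))

theorem covariance_hotellingOn_nonneg {n p k : ℕ} {Ω : Type*} [MeasurableSpace Ω]
    {P : Measure Ω} {C : Matrix (Fin p) (Fin p) ℝ} {X : Fin n → Ω → EuclideanSpace ℝ (Fin p)}
    (h : IsCenteredGaussianSample P C X) {S S' : Finset (Fin p)} (hS : S.card = k)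
    (hS' : S'.card = k) (hpos : (principalSubmatrix C S).PosDef)
    (hpos' : (principalSubmatrix C S').PosDef) :
    0 ≤ cov[hotellingOn S X, hotellingOn S' X; P] := by
  obtain ⟨U, hU, hUe⟩ := exists_submodule_hotellingTSq_eq h.posSemidef hS hpos
  obtain ⟨V, hV, hVe⟩ := exists_submodule_hotellingTSq_eq h.posSemidef hS' hpos'
  obtain ⟨u, v, ρ, hρ, huv⟩ := exists_orthonormalBasis_inner_eq_ite hU hV
  have hlaw := h.hasLaw_pi
  have hm := measurable_hotellingTSq_restrict (n := n) S
  have hm' := measurable_hotellingTSq_restrict (n := n) S'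
  have key := covariance_inner_nonneg (n := n)
    (u.orthonormal.comp_linearIsometry U.subtypeₗᵢ) (v.orthonormal.comp_linearIsometry V.subtypeₗᵢ)
    hρ huv measurable_hotellingTSq
  have e1 := covariance_map_fun (μ := P) (Z := fun ω i => X i ω) hm.aestronglyMeasurable
    hm'.aestronglyMeasurable hlaw.aemeasurable
  change _ = cov[hotellingOn S X, hotellingOn S' X; P] at e1
  rw [← e1, hlaw.map_eq, covariance_map_fun hm.aestronglyMeasurable hm'.aestronglyMeasurable
    (Measurable.aemeasurable (by fun_prop))]
  change 0 ≤ cov[fun g : Fin n → EuclideanSpace ℝ (Fin p) => hotellingTSq fun i (j : S) =>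
    Matrix.toEuclideanCLM (𝕜 := ℝ) (CFC.sqrt C) (g i) j, fun g => hotellingTSq fun i (j : S') =>
    Matrix.toEuclideanCLM (𝕜 := ℝ) (CFC.sqrt C) (g i) j; _]
  simp only [hUe u, hVe v]
  exact key

theorem exists_forall_add_le_of_tendsto_div {m : ℕ → ℕ} {ξ : ℝ} (hξ : ξ < 1)
    (hm : Tendsto (fun n : ℕ => (m n : ℝ) / (n : ℝ)) atTop (𝓝 ξ)) (r : ℕ) :
    ∃ N : ℕ, ∀ n, N ≤ n → m n + r ≤ n := by
  have h1 : ∀ᶠ n : ℕ in atTop, (m n : ℝ) / n + (r : ℝ) / n < 1 := by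
    refine (hm.add (tendsto_const_div_atTop_nhds_zero_nat (r : ℝ))).eventually_lt_const ?_
    simpa using hξ
  obtain ⟨N, hN⟩ := eventually_atTop.1 (h1.and (eventually_gt_atTop 0))
  refine ⟨N, fun n hn => ?_⟩
  obtain ⟨h, hn0⟩ := hN n hn
  have hn0' : (0 : ℝ) < n := by exact_mod_cast hn0
  rw [← add_div, div_lt_one hn0'] at h
  exact_mod_cast h.le

end

/-- Regime: `m = m n` with `m n / n → ξ ∈ (0, 1)`. From some `N` on, which depends only on the
sequence `m`, the statistics are square integrable, so that their covariance exists; and at every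
`n` at which it exists, it is nonnegative. -/
theorem theoremS1 (m : ℕ → ℕ) (ξ : ℝ) (hξ0 : 0 < ξ) (hξ1 : ξ < 1)
    (hm : Tendsto (fun n : ℕ => (m n : ℝ) / (n : ℝ)) atTop (𝓝 ξ)) :
    ∃ N : ℕ, ∀ (n p : ℕ) (C : Matrix (Fin p) (Fin p) ℝ) (S S' : Finset (Fin p)),
      S.card = m n → S'.card = m n →
      (principalSubmatrix C S).PosDef → (principalSubmatrix C S').PosDef →
      ∀ (Ω : Type*) [MeasurableSpace Ω] (P : Measure Ω) [IsProbabilityMeasure P]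
        (X : Fin n → Ω → EuclideanSpace ℝ (Fin p)), IsCenteredGaussianSample P C X →
        (N ≤ n → MemLp (hotellingOn S X) 2 P ∧ MemLp (hotellingOn S' X) 2 P) ∧
        (MemLp (hotellingOn S X) 2 P → MemLp (hotellingOn S' X) 2 P →
          0 ≤ cov[hotellingOn S X, hotellingOn S' X; P]) := by
  -- The `8` is the number of directions orthogonal to the columns used in the moment bound.
  obtain ⟨N, hN⟩ := exists_forall_add_le_of_tendsto_div hξ1 hm 8
  exact ⟨N, fun n p C S S' hS hS' hpos hpos' Ω _ P _ X hX =>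
    ⟨fun hn => ⟨memLp_hotellingOn (hN n hn) hX hS hpos, memLp_hotellingOn (hN n hn) hX hS' hpos'⟩,
      fun _ _ => covariance_hotellingOn_nonneg hX hS hS' hpos hpos'⟩⟩
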